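/- **Claim 5.1.** *The fractal sets.* Let $P$ be a set of four positions in a $4\times 4$ grid. Let $S_0=[0,1]^2$, and let $S_{\ell+1}$ be obtained from $S_\ell$ by dividing each of its $4^\ell$ squares into $16$ equal closed squares and keeping those at the positions in $P$; let $S=S(P)=\bigcap_{\ell} S_\ell$. Call $P$ admissible if the projections of $S$ on the two coordinate axes are both equal to $[0,1]$, while the projections of $S$ on the two axes of some rotated orthonormal frame of $\mathbb{R}^2$ have Lebesgue measure zero. *The notions.* For locally Lipschitz $\varphi:\mathbb{R}^\ell\to\mathbb{R}$, the Clarke subdifferential $\partial^c\varphi(x)$ is the convex hull of all limits of $\nabla\varphi(y_k)$ along sequences $y_k\to x$ of points of differentiability of $\varphi$. A set-valued map $D:\mathbb{R}^\ell\rightrightarrows\mathbb{R}^\ell$ is a conservative field for $\varphi$ if it has nonempty values and closed graph, is locally bounded, and for every absolutely continuous curve $u:[0,1]\to\mathbb{R}^\ell$ one has, for almost every $t\in[0,1]$, $\frac{d}{dt}\varphi(u(t))=\langle \dot u(t),v\rangle$ for all $v\in D(u(t))$. A locally Lipschitz function that has a conservative field is called path differentiable. Let $G(x,\theta)=x^2-4$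 on $\mathbb{R}^2$. For $F:\mathbb{R}^2\to\mathbb{R}$ and $\theta\in\mathbb{R}$ let $$f(\theta)=\min_{x\in\mathbb{R}}\{F(x,\theta): G(x,\theta)\le 0\},\qquad \mathrm{Sol_p}(\theta)=\operatorname{argmin}_{x\in\mathbb{R}}\{F(x,\theta): G(x,\theta)\le 0\},$$ let $\mathrm{Sol_{pd}}(\theta)$ be the set of pairs $(x,\lambda)$ with $x\in\mathrm{Sol_p}(\theta)$, $\lambda\ge 0$, $\lambda G(x,\theta)=0$ and $0\in\operatorname{conv}\{v_1: v\in\partial^cF(x,\theta)\}+\lambda\nabla_xG(x,\theta)$, and let $$D_f(\theta)=\{u\in\mathbb{R}:\ \exists (x,\lambda)\in\mathrm{Sol_{pd}}(\theta),\ (0,u)\in\partial^cF(x,\theta)+(\lambda\nabla_xG(x,\theta),0)\}.$$ *The claim.* Admissible sets $P$ exist, and for every admissible $P$, with $S=S(P)$, there is a locally Lipschitz function $F:\mathbb{R}^2\to\mathbb{R}$ such that: (i) $F$ is not definable in any o-minimal structure on $(\mathbb{R},+,\cdot)$; (ii) $F$ is differentiable and path differentiable on $\mathbb{R}^2$, and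 continuously differentiable on $\mathbb{R}^2\setminus S$; (iii) Robinson's constraint qualification holds at every feasible point: if $G(x,\theta)\le0$, $\lambda\ge0$, $\lambda G(x,\theta)=0$ and $\lambda\nabla_xG(x,\theta)=0$, then $\lambda=0$; moreover $\mathrm{Sol_p}$ has nonempty values and is locally bounded; (iv) for every $\theta\in[0,1]$, $f(\theta)=0$ and $[-1,1]\subset D_f(\theta)$; and $D_f$ is not a conservative field for $f$. -/

import Mathlib

open Set Filter Topology MeasureTheory

noncomputable section

namespace AdjointFailure

/-! ### Clarke subdifferential and conservative fields -/

section Nonsmooth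

variable {E : Type*} [NormedAddCommGroup E] [InnerProductSpace ℝ E]

/-- The Clarke subdifferential of `φ` at `x`: the convex hull of all limits of gradients
`∇ φ (y k)` along sequences `y k → x` of points of differentiability of `φ`. -/
def clarkeSubdiff [CompleteSpace E] (φ : E → ℝ) (x : E) : Set E :=
  convexHull ℝ {v : E | ∃ y : ℕ → E, (∀ k, DifferentiableAt ℝ φ (y k)) ∧
    Tendsto y atTop (𝓝 x) ∧ Tendsto (fun k => gradient φ (y k)) atTop (𝓝 v)}

/-- A set-valued map is locally bounded if around each point it has a neighbourhood on which all
its values lie in one ball. -/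
def IsLocallyBounded {X Y : Type*} [TopologicalSpace X] [NormedAddCommGroup Y]
    (D : X → Set Y) : Prop :=
  ∀ x, ∃ N ∈ 𝓝 x, ∃ r > (0 : ℝ), (⋃ z ∈ N, D z) ⊆ Metric.closedBall 0 r

/-- A set-valued map has closed graph. -/
def IsGraphClosed {X Y : Type*} [TopologicalSpace X] [TopologicalSpace Y]
    (D : X → Set Y) : Prop :=
  IsClosed {p : X × Y | p.2 ∈ D p.1}

/-- Absolutely continuous curves `u : [0, 1] → E`. The curve is given as a function on `ℝ`, of
which only the restriction to `[0, 1]` matters. -/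
structure IsAbsContCurve (u : ℝ → E) : Prop where
  ae_differentiable : ∀ᵐ t ∂(volume.restrict (Icc (0 : ℝ) 1)), DifferentiableAt ℝ u t
  integrable_deriv : IntegrableOn (deriv u) (Icc (0 : ℝ) 1)
  sub_eq_integral : ∀ a ∈ Icc (0 : ℝ) 1, ∀ b ∈ Icc (0 : ℝ) 1, u b - u a = ∫ t in a..b, deriv u t

/-- The set-valued map `D` is a conservative field for the locally Lipschitz function `φ`. -/
structure IsConservativeField (φ : E → ℝ) (D : E → Set E) : Prop where
  locallyLipschitz : LocallyLipschitz φ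
  nonempty : ∀ x, (D x).Nonempty
  locallyBounded : IsLocallyBounded D
  graphClosed : IsGraphClosed D
  chainRule : ∀ u : ℝ → E, IsAbsContCurve u →
    ∀ᵐ t ∂(volume.restrict (Icc (0 : ℝ) 1)), ∀ v ∈ D (u t),
      HasDerivAt (fun s => φ (u s)) (inner ℝ (deriv u t) v) t

/-- A function is path differentiable if it admits a conservative field. -/
def PathDifferentiable (φ : E → ℝ) : Prop :=
  ∃ D : E → Set E, IsConservativeField φ D

end Nonsmooth

/-! ### O-minimal structures -/

/-- An o-minimal structure on `(ℝ, +, ·)`. -/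
structure OMinimalStructure where
  /-- The definable subsets of `ℝ^l`. -/
  sets : ∀ l : ℕ, Set (Set (Fin l → ℝ))
  compl_mem : ∀ {l : ℕ} {A : Set (Fin l → ℝ)}, A ∈ sets l → Aᶜ ∈ sets l
  union_mem : ∀ {l : ℕ} {A B : Set (Fin l → ℝ)}, A ∈ sets l → B ∈ sets l → A ∪ B ∈ sets l
  inter_mem : ∀ {l : ℕ} {A B : Set (Fin l → ℝ)}, A ∈ sets l → B ∈ sets l → A ∩ B ∈ sets l
  /-- `A × ℝ` is definable if `A` is. -/
  prod_univ_mem : ∀ {l : ℕ} {A : Set (Fin l → ℝ)}, A ∈ sets l →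
    {w : Fin (l + 1) → ℝ | Fin.init w ∈ A} ∈ sets (l + 1)
  /-- `ℝ × A` is definable if `A` is. -/
  univ_prod_mem : ∀ {l : ℕ} {A : Set (Fin l → ℝ)}, A ∈ sets l →
    {w : Fin (l + 1) → ℝ | Fin.tail w ∈ A} ∈ sets (l + 1)
  /-- The image under the projection onto the first `l` coordinates. -/
  proj_mem : ∀ {l : ℕ} {A : Set (Fin (l + 1) → ℝ)}, A ∈ sets (l + 1) →
    (fun w : Fin (l + 1) → ℝ => (Fin.init w : Fin l → ℝ)) '' A ∈ sets l
  algebraic_mem : ∀ {l : ℕ} (p : MvPolynomial (Fin l) ℝ),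
    {w : Fin l → ℝ | MvPolynomial.eval w p = 0} ∈ sets l
  /-- The definable subsets of `ℝ` are the finite unions of points and intervals
  (the order-connected subsets of `ℝ`, bounded or not). -/
  mem_one_iff : ∀ A : Set (Fin 1 → ℝ), A ∈ sets 1 ↔
    ∃ T : Set (Set ℝ), T.Finite ∧ (∀ I ∈ T, I.OrdConnected) ∧ A = {w | w 0 ∈ ⋃₀ T}

/-- The plane `ℝ²` with its Euclidean norm; the coordinates of a point are `(x, θ)`. -/
abbrev Plane : Type := EuclideanSpace ℝ (Fin 2)

/-- `F : ℝ² → ℝ` is definable in `O`: its graph is a definable subset of `ℝ³`. -/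
def IsDefinable (O : OMinimalStructure) (F : Plane → ℝ) : Prop :=
  {w : Fin 3 → ℝ | F !₂[w 0, w 1] = w 2} ∈ O.sets 3

/-! ### The fractal set -/

/-- The `l`-th approximation of the fractal with kept positions `P`: start from the closed unit
square, divide it into `4 × 4` squares of equal size, keep those whose (column, row) lies in `P`,
and repeat in each kept square. Thus the set of level `l + 1` is the union over `p ∈ P` of the
copies `(p + z) / 4`, `z` in the set of level `l`. -/
def fractalLevel (P : Finset (Fin 4 × Fin 4)) : ℕ → Set Plane
  | 0 => {z | z 0 ∈ Icc (0 : ℝ) 1 ∧ z 1 ∈ Icc (0 : ℝ) 1}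
  | l + 1 => ⋃ p ∈ P,
      (fun z : Plane => (!₂[((p.1 : ℕ) + z 0) / 4, ((p.2 : ℕ) + z 1) / 4] : Plane)) ''
        fractalLevel P l

/-- The fractal set with kept positions `P`. -/
def fractal (P : Finset (Fin 4 × Fin 4)) : Set Plane :=
  ⋂ l : ℕ, fractalLevel P l

/-- Four positions are kept, the projections of the fractal on the two coordinate axes are full
segments, and its projections on the two axes of some rotated frame are Lebesgue null. -/
structure IsAdmissible (P : Finset (Fin 4 × Fin 4)) : Prop where
  card_eq : P.card = 4
  proj_fst : (fun z : Plane => z 0) '' fractal P = Icc 0 1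
  proj_snd : (fun z : Plane => z 1) '' fractal P = Icc 0 1
  proj_rotated : ∃ α : ℝ,
    volume ((fun z : Plane => Real.cos α * z 0 + Real.sin α * z 1) '' fractal P) = 0 ∧
    volume ((fun z : Plane => -Real.sin α * z 0 + Real.cos α * z 1) '' fractal P) = 0

/-! ### The parametric problem: minimize `F (x, θ)` over `x ∈ ℝ` subject to `G (x, θ) ≤ 0` -/

section Problem

variable (F G : Plane → ℝ)

/-- The feasible set at the parameter `θ`. -/
def feasible (θ : ℝ) : Set ℝ := {x | G !₂[x, θ] ≤ 0}

/-- The value function (the infimum is a minimum as soon as `solP F G θ` is nonempty). -/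
def valueFunction (θ : ℝ) : ℝ := sInf ((fun x : ℝ => F !₂[x, θ]) '' feasible G θ)

/-- The set of primal solutions. -/
def solP (θ : ℝ) : Set ℝ :=
  {x | x ∈ feasible G θ ∧ ∀ y ∈ feasible G θ, F !₂[x, θ] ≤ F !₂[y, θ]}

/-- The partial derivative of `G` in `x` at `(x, θ)`. -/
def gradX (x θ : ℝ) : ℝ := deriv (fun s : ℝ => G !₂[s, θ]) x

/-- Robinson's constraint qualification at `(x, θ)` for the constraint `G (x, θ) ∈ K`, where
`K = (-∞, 0]` has the polar cone `[0, ∞)`. -/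
def RCQ (x θ : ℝ) : Prop :=
  ∀ l : ℝ, l * gradX G x θ = 0 → 0 ≤ l → l * G !₂[x, θ] = 0 → l = 0

/-- The multipliers satisfying stationarity and complementarity, where the field used for
`F (·, θ)` is the projection on the `x` component of the Clarke subdifferential of `F`. -/
def kkt (x θ : ℝ) : Set ℝ :=
  {l | (∃ w ∈ convexHull ℝ ((fun v : Plane => v 0) '' clarkeSubdiff F !₂[x, θ]),
      0 = w + l * gradX G x θ) ∧ 0 ≤ l ∧ l * G !₂[x, θ] = 0}

/-- The set of primal-dual solutions. -/
def solPD (θ : ℝ) : Set (ℝ × ℝ) := {p | p.1 ∈ solP F G θ ∧ p.2 ∈ kkt F G p.1 θ}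

/-- The Clarke-based adjoint map `D_f`, for a constraint function `G` that does not depend
on `θ`. -/
def adjointMap (θ : ℝ) : Set ℝ :=
  {u | ∃ p ∈ solPD F G θ, ∃ v ∈ clarkeSubdiff F !₂[p.1, θ],
    (!₂[0, u] : Plane) = v + !₂[p.2 * gradX G p.1 θ, 0]}

end Problem

/-- The constraint function `G (x, θ) = x ^ 2 - 4`. -/
def constraintG : Plane → ℝ := fun z => z 0 ^ 2 - 4

end AdjointFailure

end

open AdjointFailure

/-! # A fractal, nondefinable objective with a failing adjoint map

The objective is a sum of disjoint `C¹` bumps accumulating exactly at the fractal, so small that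
the sum is differentiable on the fractal while every unit vector is a limiting gradient there. -/

namespace AdjointFailure

/-! ### Definability -/

namespace OMinimalStructure

variable (O : OMinimalStructure)

/-! A set `S` whose projections on the axes of some orthonormal frame are null is invisible to
curves: almost every time spent in `S` has zero velocity
(`volume_deriv_ne_zero_of_null_projections`). On a closed such `S` a conservative field may thus
take any values in a fixed ball, so a differentiable function with bounded gradient that is `C¹` off
`S` is path differentiable, however wild its gradients near `S`
(`pathDifferentiable_of_contDiffOn_compl`). If `S` also projects onto the whole segment `[0, 1]` of
parameters, this wildness can be placed at a minimizer for every such parameter.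

`F` is a sum of disjoint bumps whose centres lie off `S` and accumulate at each of its points. A
bump centred at distance `d` from `S` has radius `d ^ 2 / 4` and height proportional to its radius.
The heights are `O(d ^ 2)`, so `F` vanishes on `S` with zero derivative; the gradients are scale
free, and every unit vector is attained in every bump, hence lies in the Clarke subdifferential on
`S` (`mem_clarkeSubdiff_bumpSum`). Since `F ≥ 0`, points of `S` are minimizers with multiplier `0`.
So the adjoint map contains `[-1, 1]` where the value function is constantly `0`, and the chain rule
fails along the curve `t ↦ t`.

The positive local maximum points of `F` are exactly the bump centres, a countably infinite set;
o-minimality forces a countable definable set to be finite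
(`not_isDefinable_of_countable_localMax`). -/

theorem preimage_addNat_mem {m : ℕ} {A : Set (Fin m → ℝ)} (hA : A ∈ O.sets m) (n : ℕ) :
    {w : Fin (m + n) → ℝ | (fun i => w (Fin.addNat i n)) ∈ A} ∈ O.sets (m + n) := by
  induction n with
  | zero => exact hA
  | succ n ih => exact O.univ_prod_mem ih

theorem preimage_cast_mem {m n : ℕ} (h : m = n) {A : Set (Fin m → ℝ)} (hA : A ∈ O.sets m) :
    {w : Fin n → ℝ | (fun i => w (Fin.cast h i)) ∈ A} ∈ O.sets n := by
  subst h
  exact hA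

theorem preimage_natAdd_mem {m : ℕ} {A : Set (Fin m → ℝ)} (hA : A ∈ O.sets m) (n : ℕ) :
    {w : Fin (n + m) → ℝ | (fun i => w (Fin.natAdd n i)) ∈ A} ∈ O.sets (n + m) := by
  have h := O.preimage_cast_mem (Nat.add_comm m n) (O.preimage_addNat_mem hA n)
  have hi : ∀ i : Fin m, Fin.cast (Nat.add_comm m n) (i.addNat n) = Fin.natAdd n i := fun i => by
    ext
    simp
  simpa only [mem_ofPred_eq, hi] using h

/-- Existential quantification over `m` real variables; formulas are translated into definable sets
through it. -/
theorem image_castAdd_mem {n m : ℕ} {A : Set (Fin (n + m) → ℝ)} (hA : A ∈ O.sets (n + m)) :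
    (fun (u : Fin (n + m) → ℝ) (i : Fin n) => u (Fin.castAdd m i)) '' A ∈ O.sets n := by
  induction m with
  | zero =>
    have h := image_id' A
    exact h.symm ▸ hA
  | succ m ih =>
    have h := ih (O.proj_mem hA)
    rw [image_image] at h
    exact h

/-- Definable sets are stable under preimages by polynomial maps. -/
theorem preimage_polynomial_mem {m n : ℕ} {A : Set (Fin m → ℝ)} (hA : A ∈ O.sets m)
    (p : Fin m → MvPolynomial (Fin n) ℝ) :
    {w : Fin n → ℝ | (fun i => MvPolynomial.eval w (p i)) ∈ A} ∈ O.sets n := by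
  -- The graph of the polynomial map is the zero set of one polynomial, a sum of squares. It is cut
  -- by `A` in the last `m` coordinates, which are then projected away.
  have h := O.image_castAdd_mem (O.inter_mem (O.preimage_natAdd_mem hA n)
    (O.algebraic_mem (∑ i : Fin m, (MvPolynomial.X (Fin.natAdd n i) -
      MvPolynomial.rename (Fin.castAdd m) (p i)) ^ 2)))
  convert h using 1
  ext w
  constructor
  · intro hw
    refine ⟨Fin.append w (fun i => MvPolynomial.eval w (p i)), ⟨?_, ?_⟩, ?_⟩
    · simpa using hw
    · simp [MvPolynomial.eval_rename, Function.comp_def]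
    · simp
  · rintro ⟨u, ⟨hu, hp⟩, rfl⟩
    simp only [mem_ofPred_eq, map_sum, map_pow, map_sub, MvPolynomial.eval_X,
      MvPolynomial.eval_rename] at hp hu ⊢
    rw [Finset.sum_eq_zero_iff_of_nonneg (fun i _ => sq_nonneg _)] at hp
    convert hu using 2 with i
    have := hp i (Finset.mem_univ i)
    rw [sq_eq_zero_iff, sub_eq_zero] at this
    exact this.symm

theorem setOf_pos_mem {n : ℕ} (p : MvPolynomial (Fin n) ℝ) :
    {w : Fin n → ℝ | 0 < MvPolynomial.eval w p} ∈ O.sets n := by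
  have h : {w : Fin 1 → ℝ | 0 < w 0} ∈ O.sets 1 :=
    (O.mem_one_iff _).2 ⟨{Ioi 0}, finite_singleton _, by simp [ordConnected_Ioi], by simp⟩
  exact O.preimage_polynomial_mem h (fun _ => p)

/-- A countable order-connected set has at most one point, since nontrivial intervals are
uncountable. -/
theorem finite_of_countable {A : Set (Fin 1 → ℝ)} (hA : A ∈ O.sets 1) (hc : A.Countable) :
    A.Finite := by
  obtain ⟨T, hT, hI, rfl⟩ := (O.mem_one_iff A).1 hA
  have hc' : (⋃₀ T).Countable := by
    exact (hc.image (fun w => w 0)).mono fun x hx => mem_image_of_mem (fun w : Fin 1 → ℝ => w 0)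
      (show (fun _ => x) ∈ {w : Fin 1 → ℝ | w 0 ∈ ⋃₀ T} from hx)
  have hf : (⋃₀ T).Finite := by
    refine hT.sUnion fun I hIT => Set.Subsingleton.finite ?_
    have hIc : I.Countable := hc'.mono (subset_sUnion_of_mem hIT)
    have key : ∀ a ∈ I, ∀ b ∈ I, ¬ a < b := fun a ha b hb hab =>
      (Cardinal.Real.Icc_countable_iff.1 (hIc.mono ((hI I hIT).out ha hb))).not_gt hab
    intro a ha b hb
    exact le_antisymm (not_lt.1 (key b hb a ha)) (not_lt.1 (key a ha b hb))
  refine (hf.preimage (f := fun w : Fin 1 → ℝ => w 0) ?_).subset fun w hw => hw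
  intro u _ v _ huv
  ext i
  rw [Subsingleton.elim i 0]
  exact huv

end OMinimalStructure

theorem IsDefinable.graph_mem {O : OMinimalStructure} {F : Plane → ℝ} (hF : IsDefinable O F)
    {n : ℕ} (i j k : Fin n) : {w : Fin n → ℝ | F !₂[w i, w j] = w k} ∈ O.sets n := by
  have h := O.preimage_polynomial_mem hF
    ![MvPolynomial.X i, MvPolynomial.X j, MvPolynomial.X k]
  simpa using h

/-- The set of positive local maximum points of a definable function is definable. -/
theorem IsDefinable.localMax_mem {O : OMinimalStructure} {F : Plane → ℝ}
    (hF : IsDefinable O F) :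
    {w : Fin 2 → ℝ | 0 < F !₂[w 0, w 1] ∧ IsLocalMax F !₂[w 0, w 1]} ∈ O.sets 2 := by
  -- Here `w 2` plays the squared radius of a ball around `(w 0, w 1)` and `w 3` a value exceeded in
  -- that ball. A local maximum is a point for which some positive `w 2`, with `w 3` the value of
  -- `F` there, lies in the complement.
  have hB : {w : Fin 4 → ℝ | ∃ x y : ℝ, (x - w 0) ^ 2 + (y - w 1) ^ 2 < w 2 ∧
      w 3 < F !₂[x, y]} ∈ O.sets 4 := by
    have h := O.image_castAdd_mem (n := 4) (m := 3) (O.inter_mem (hF.graph_mem 4 5 6)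
      (O.inter_mem
        (O.setOf_pos_mem (MvPolynomial.X 2 - ((MvPolynomial.X 4 - MvPolynomial.X 0) ^ 2 +
          (MvPolynomial.X 5 - MvPolynomial.X 1) ^ 2)))
        (O.setOf_pos_mem (MvPolynomial.X 6 - MvPolynomial.X 3))))
    convert h using 1
    ext w
    constructor
    · rintro ⟨x, y, h1, h2⟩
      refine ⟨![w 0, w 1, w 2, w 3, x, y, F !₂[x, y]], ⟨?_, ?_, ?_⟩, ?_⟩
      · simp
      · simpa using h1
      · simpa using h2
      · ext i
        fin_cases i <;> rfl
    · rintro ⟨u, ⟨h1, h2, h3⟩, rfl⟩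
      simp only [mem_ofPred_eq, map_sub, map_add, map_pow, MvPolynomial.eval_X,
        sub_pos] at h1 h2 h3
      exact ⟨u 4, u 5, h2, h1 ▸ h3⟩
  have h := O.image_castAdd_mem (n := 2) (m := 2) (O.inter_mem (O.compl_mem hB)
    (O.inter_mem (hF.graph_mem 0 1 3)
      (O.inter_mem (O.setOf_pos_mem (MvPolynomial.X 2)) (O.setOf_pos_mem (MvPolynomial.X 3)))))
  convert h using 1
  have hball : ∀ (a b δ : ℝ) (z : Plane), 0 < δ →
      (z ∈ Metric.ball (!₂[a, b] : Plane) δ ↔ (z 0 - a) ^ 2 + (z 1 - b) ^ 2 < δ ^ 2) := by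
    intro a b δ z hδ
    rw [Metric.mem_ball, EuclideanSpace.dist_eq, Real.sqrt_lt' hδ]
    simp [Real.dist_eq]
  ext w
  constructor
  · rintro ⟨h0, hm⟩
    obtain ⟨δ, hδ, hball'⟩ := Metric.eventually_nhds_iff_ball.1 hm
    refine ⟨![w 0, w 1, δ ^ 2, F !₂[w 0, w 1]], ⟨?_, ?_, ?_, ?_⟩, ?_⟩
    · rintro ⟨x, y, h1, h2⟩
      refine (hball' !₂[x, y] ((hball _ _ _ _ hδ).2 ?_)).not_gt h2
      simpa using h1
    · simp
    · simpa using pow_pos hδ 2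
    · simpa using h0
    · ext i
      fin_cases i <;> rfl
  · rintro ⟨u, ⟨h1, h2, h3, h4⟩, rfl⟩
    simp only [mem_ofPred_eq, MvPolynomial.eval_X] at h2 h3 h4
    refine ⟨lt_of_lt_of_eq h4 h2.symm, ?_⟩
    refine Metric.eventually_nhds_iff_ball.2 ⟨√(u 2), Real.sqrt_pos.2 h3, fun z hz => ?_⟩
    rw [hball _ _ _ _ (Real.sqrt_pos.2 h3), Real.sq_sqrt h3.le] at hz
    by_contra! hlt
    refine h1 ⟨z 0, z 1, hz, ?_⟩
    have hz' : (!₂[z 0, z 1] : Plane) = z := by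
      ext i
      fin_cases i <;> rfl
    rw [hz', ← h2]
    exact hlt

/-- In an o-minimal structure, a definable function has finitely many or uncountably many
positive local maximum points. -/
theorem not_isDefinable_of_countable_localMax {F : Plane → ℝ}
    (hc : {z | 0 < F z ∧ IsLocalMax F z}.Countable)
    (hinf : {z | 0 < F z ∧ IsLocalMax F z}.Infinite) (O : OMinimalStructure) :
    ¬ IsDefinable O F := by
  intro hF
  set A := {w : Fin 2 → ℝ | 0 < F !₂[w 0, w 1] ∧ IsLocalMax F !₂[w 0, w 1]} with hA
  have hAO : A ∈ O.sets 2 := hF.localMax_mem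
  have hη : ∀ z : Plane, (!₂[z 0, z 1] : Plane) = z := fun z => by
    ext i
    fin_cases i <;> rfl
  have hAc : A.Countable := by
    refine (hc.image (fun z : Plane => (![z 0, z 1] : Fin 2 → ℝ))).mono
      fun (w : Fin 2 → ℝ) hw => ?_
    refine (mem_image _ _ _).2 ⟨!₂[w 0, w 1], hw, ?_⟩
    ext i
    fin_cases i <;> rfl
  -- Projections keep the first coordinate, so the second one is reached by swapping.
  have hA' : {w : Fin 2 → ℝ | (![w 1, w 0] : Fin 2 → ℝ) ∈ A} ∈ O.sets 2 := by
    have := O.preimage_polynomial_mem (n := 2) hAO ![MvPolynomial.X 1, MvPolynomial.X 0]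
    convert this using 4
    ext i
    fin_cases i <;> simp
  have hAc' : {w : Fin 2 → ℝ | (![w 1, w 0] : Fin 2 → ℝ) ∈ A}.Countable := by
    refine (hAc.image (fun w : Fin 2 → ℝ => (![w 1, w 0] : Fin 2 → ℝ))).mono
      fun (w : Fin 2 → ℝ) hw => ?_
    refine (mem_image _ _ _).2 ⟨![w 1, w 0], hw, ?_⟩
    ext i
    fin_cases i <;> rfl
  -- Both coordinate projections of `A` are countable and definable in `ℝ`, hence finite, and `A`
  -- lies in their product.
  have f0 := O.finite_of_countable (O.image_castAdd_mem (n := 1) (m := 1) hAO) (hAc.image _)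
  have f1 := O.finite_of_countable (O.image_castAdd_mem (n := 1) (m := 1) hA') (hAc'.image _)
  refine hinf (((f0.prod f1).preimage
    (f := fun z : Plane => ((fun _ => z 0 : Fin 1 → ℝ), (fun _ => z 1 : Fin 1 → ℝ))) ?_).subset ?_)
  · intro z _ z' _ h
    simp only [Prod.mk.injEq] at h
    ext i
    fin_cases i
    · exact congrFun h.1 0
    · exact congrFun h.2 0
  · intro z hz
    refine ⟨⟨![z 0, z 1], ?_, ?_⟩, ⟨![z 1, z 0], ?_, ?_⟩⟩
    · simpa [hA, hη z] using hz
    · ext i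
      rw [Subsingleton.elim i 0]
      rfl
    · simpa [hA, hη z] using hz
    · ext i
      rw [Subsingleton.elim i 0]
      rfl

end AdjointFailure

namespace AdjointFailure

/-! ### The fractal -/

open scoped Pointwise

theorem isCompact_fractalLevel (P : Finset (Fin 4 × Fin 4)) (l : ℕ) :
    IsCompact (fractalLevel P l) := by
  induction l with
  | zero =>
    have h : fractalLevel P 0 = (WithLp.toLp 2 : (Fin 2 → ℝ) → Plane) ''
        (Set.pi univ fun _ => Icc (0 : ℝ) 1) := by
      ext z
      constructor
      · intro hz
        refine ⟨z.ofLp, ?_, rfl⟩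
        intro i _
        fin_cases i
        · exact hz.1
        · exact hz.2
      · rintro ⟨w, hw, rfl⟩
        exact ⟨hw 0 trivial, hw 1 trivial⟩
    rw [h]
    exact (isCompact_univ_pi fun _ => isCompact_Icc).image (by fun_prop)
  | succ l ih =>
    refine P.isCompact_biUnion fun p _ => ih.image ?_
    refine (PiLp.continuous_toLp 2 _).comp (continuous_pi fun i => ?_)
    fin_cases i <;> simp <;> fun_prop

theorem fractalLevel_succ_subset (P : Finset (Fin 4 × Fin 4)) (l : ℕ) :
    fractalLevel P (l + 1) ⊆ fractalLevel P l := by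
  induction l with
  | zero =>
    intro z hz
    simp only [fractalLevel, mem_iUnion] at hz
    obtain ⟨⟨i, j⟩, -, w, ⟨⟨h1, h2⟩, h3, h4⟩, rfl⟩ := hz
    have hi : ((i : ℕ) : ℝ) ≤ 3 := by exact_mod_cast Nat.le_of_lt_succ i.2
    have hj : ((j : ℕ) : ℝ) ≤ 3 := by exact_mod_cast Nat.le_of_lt_succ j.2
    have hi' : (0 : ℝ) ≤ (i : ℕ) := Nat.cast_nonneg _
    have hj' : (0 : ℝ) ≤ (j : ℕ) := Nat.cast_nonneg _
    refine ⟨⟨?_, ?_⟩, ?_, ?_⟩ <;> simp <;> linarith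
  | succ l ih =>
    exact biUnion_mono subset_rfl fun p _ => image_mono ih

theorem isClosed_fractal (P : Finset (Fin 4 × Fin 4)) : IsClosed (fractal P) :=
  isClosed_iInter fun l => (isCompact_fractalLevel P l).isClosed

theorem fractal_subset_unitSquare {P : Finset (Fin 4 × Fin 4)} {z : Plane} (hz : z ∈ fractal P) :
    z 0 ∈ Icc (0 : ℝ) 1 ∧ z 1 ∈ Icc (0 : ℝ) 1 :=
  mem_iInter.1 hz 0

theorem exists_digit {x : ℝ} (hx : x ∈ Icc (0 : ℝ) 1) :
    ∃ i : Fin 4, 4 * x - (i : ℕ) ∈ Icc (0 : ℝ) 1 := by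
  obtain ⟨h0, h1⟩ := hx
  rcases le_total (4 * x) 1 with h | h
  · exact ⟨0, by simp; constructor <;> linarith⟩
  rcases le_total (4 * x) 2 with h' | h'
  · exact ⟨1, by norm_num; constructor <;> linarith⟩
  rcases le_total (4 * x) 3 with h'' | h''
  · exact ⟨2, by norm_num; constructor <;> linarith⟩
  · exact ⟨3, by norm_num; constructor <;> linarith⟩

/-- If all four columns occur in `P`, the first projection of the fractal is full; the same with
rows and the second projection. -/
theorem image_coord_fractal {P : Finset (Fin 4 × Fin 4)} (k : Fin 2)
    (hP : ∀ i : Fin 4, ∃ p ∈ P, ![p.1, p.2] k = i) :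
    (fun z : Plane => z k) '' fractal P = Icc 0 1 := by
  refine Subset.antisymm ?_ fun x hx => ?_
  · rintro _ ⟨z, hz, rfl⟩
    have := fractal_subset_unitSquare hz
    fin_cases k
    · exact this.1
    · exact this.2
  have hlevel : ∀ l : ℕ, ∀ x ∈ Icc (0 : ℝ) 1, ∃ z ∈ fractalLevel P l, z k = x := by
    intro l
    induction l with
    | zero =>
      intro x hx
      exact ⟨!₂[x, x], ⟨by simpa using hx, by simpa using hx⟩, by fin_cases k <;> rfl⟩
    | succ l ih =>
      intro x hx
      obtain ⟨i, hi⟩ := exists_digit hx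
      obtain ⟨p, hp, hpi⟩ := hP i
      obtain ⟨z, hz, hzx⟩ := ih _ hi
      refine ⟨_, mem_biUnion hp ⟨z, hz, rfl⟩, ?_⟩
      fin_cases k
      · simp at hpi hzx ⊢
        rw [hzx, hpi]
        ring
      · simp at hpi hzx ⊢
        rw [hzx, hpi]
        ring
  have hcl : IsClosed {z : Plane | z k = x} :=
    isClosed_eq (by fun_prop) continuous_const
  -- The fibres over `x` in the successive levels are nested nonempty compact sets.
  have hne := IsCompact.nonempty_iInter_of_sequence_nonempty_isCompact_isClosed
    (fun l => fractalLevel P l ∩ {z : Plane | z k = x})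
    (fun l => inter_subset_inter_left _ (fractalLevel_succ_subset P l))
    (fun l => by
      obtain ⟨z, hz, hzx⟩ := hlevel l x hx
      exact ⟨z, hz, hzx⟩)
    ((isCompact_fractalLevel P 0).inter_right hcl)
    (fun l => ((isCompact_fractalLevel P l).inter_right hcl).isClosed)
  obtain ⟨z, hz⟩ := hne
  exact ⟨z, mem_iInter.2 fun l => (mem_iInter.1 hz l).1, (mem_iInter.1 hz 0).2⟩

/-- A linear functional taking only two values on `P` maps the fractal to a null set. -/
theorem volume_image_fractal_eq_zero {P : Finset (Fin 4 × Fin 4)} {a b d₁ d₂ : ℝ}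
    (hP : ∀ p ∈ P, a * (p.1 : ℕ) + b * (p.2 : ℕ) = d₁ ∨ a * (p.1 : ℕ) + b * (p.2 : ℕ) = d₂) :
    volume ((fun z : Plane => a * z 0 + b * z 1) '' fractal P) = 0 := by
  set L : Plane → ℝ := fun z => a * z 0 + b * z 1 with hL
  have hLc : Continuous L := by fun_prop
  -- Two translates of a copy scaled by `1 / 4` cover the next image, so its measure at least halves
  -- at each level.
  have hsub : ∀ l, L '' fractalLevel P (l + 1) ⊆
      (fun x => d₁ / 4 + x) '' ((4⁻¹ : ℝ) • (L '' fractalLevel P l)) ∪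
      (fun x => d₂ / 4 + x) '' ((4⁻¹ : ℝ) • (L '' fractalLevel P l)) := by
    rintro l _ ⟨z, hz, rfl⟩
    simp only [fractalLevel, mem_iUnion] at hz
    obtain ⟨p, hp, w, hw, rfl⟩ := hz
    rcases hP p hp with h | h
    · refine Or.inl ⟨(4⁻¹ : ℝ) • L w, smul_mem_smul_set ⟨w, hw, rfl⟩, ?_⟩
      simp [hL, ← h]
      ring
    · refine Or.inr ⟨(4⁻¹ : ℝ) • L w, smul_mem_smul_set ⟨w, hw, rfl⟩, ?_⟩
      simp [hL, ← h]
      ring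
  have hstep : ∀ l, volume (L '' fractalLevel P (l + 1)) ≤
      2⁻¹ * volume (L '' fractalLevel P l) := by
    intro l
    refine (measure_mono (hsub l)).trans ((measure_union_le _ _).trans ?_)
    rw [image_add_left, image_add_left, measure_preimage_add, measure_preimage_add,
      Measure.addHaar_smul, ← two_mul, ← mul_assoc]
    gcongr
    rw [show (2 : ENNReal) = ENNReal.ofReal 2 by simp, ← ENNReal.ofReal_mul (by norm_num),
      ← ENNReal.ofReal_inv_of_pos (by norm_num)]
    apply ENNReal.ofReal_le_ofReal
    simp
    norm_num
  have hpow : ∀ l, volume (L '' fractal P) ≤ 2⁻¹ ^ l * volume (L '' fractalLevel P 0) := by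
    intro l
    refine (measure_mono (image_mono (iInter_subset _ l))).trans ?_
    induction l with
    | zero => simp
    | succ l ih =>
      refine (hstep l).trans ?_
      rw [pow_succ', mul_assoc]
      gcongr
  have hfin : volume (L '' fractalLevel P 0) ≠ ⊤ :=
    ((isCompact_fractalLevel P 0).image hLc).measure_lt_top.ne
  have hlim : Tendsto (fun l : ℕ => (2⁻¹ : ENNReal) ^ l * volume (L '' fractalLevel P 0)) atTop
      (𝓝 (0 * volume (L '' fractalLevel P 0))) :=
    ENNReal.Tendsto.mul_const
      (ENNReal.tendsto_pow_atTop_nhds_zero_of_lt_one (by simp)) (Or.inr hfin)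
  rw [zero_mul] at hlim
  exact le_antisymm (ge_of_tendsto' hlim hpow) zero_le

/-- The positions form a permutation, so both coordinate projections are full. On them `x + 2 y`
takes only the values `2, 7` and `-2 x + y` only `1, -4`; the angle `arctan 2` normalizes these two
functionals. -/
theorem exists_isAdmissible : ∃ P : Finset (Fin 4 × Fin 4), IsAdmissible P := by
  refine ⟨{(0, 1), (1, 3), (2, 0), (3, 2)}, by decide, image_coord_fractal 0 (by decide),
    image_coord_fractal 1 (by decide), Real.arctan 2, ?_, ?_⟩
  · refine volume_image_fractal_eq_zero (d₁ := 2 / √(1 + 2 ^ 2)) (d₂ := 7 / √(1 + 2 ^ 2)) ?_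
    rw [Real.cos_arctan, Real.sin_arctan]
    intro p hp
    fin_cases hp
    · left; norm_num
    · right; norm_num; ring
    · left; norm_num; ring
    · right; norm_num; ring
  · refine volume_image_fractal_eq_zero (d₁ := 1 / √(1 + 2 ^ 2)) (d₂ := -4 / √(1 + 2 ^ 2)) ?_
    rw [Real.cos_arctan, Real.sin_arctan]
    intro p hp
    fin_cases hp
    · left; norm_num
    · left; norm_num; ring
    · right; norm_num; ring
    · right; norm_num; ring

end AdjointFailure

namespace AdjointFailure

/-! ### Parabolic bumps -/

theorem hasDerivAt_max_zero_sq (t : ℝ) :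
    HasDerivAt (fun s : ℝ => max 0 s ^ 2) (2 * max 0 t) t := by
  rcases lt_trichotomy t 0 with h | rfl | h
  · rw [max_eq_left h.le, mul_zero]
    refine (hasDerivAt_const t (0 : ℝ)).congr_of_eventuallyEq ?_
    filter_upwards [eventually_lt_nhds h] with s hs
    simp [max_eq_left hs.le]
  · rw [hasDerivAt_iff_isLittleO]
    have h1 : (fun s : ℝ => max 0 s ^ 2) =O[𝓝 0] fun s : ℝ => s ^ 2 := by
      refine Asymptotics.IsBigO.of_bound 1 (Eventually.of_forall fun s => ?_)
      rw [norm_pow, norm_pow, one_mul]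
      gcongr
      rcases le_total 0 s with hs | hs
      · rw [max_eq_right hs]
      · simp [max_eq_left hs]
    simpa using h1.trans_isLittleO (Asymptotics.isLittleO_pow_id one_lt_two)
  · rw [max_eq_right h.le]
    have := hasDerivAt_pow 2 t
    refine HasDerivAt.congr_of_eventuallyEq (f := fun s : ℝ => s ^ 2) (by simpa using this) ?_
    filter_upwards [eventually_gt_nhds h] with s hs
    simp [max_eq_right hs.le]

theorem contDiff_max_zero_sq : ContDiff ℝ 1 (fun s : ℝ => max 0 s ^ 2) := by
  rw [contDiff_one_iff_deriv]
  refine ⟨fun t => (hasDerivAt_max_zero_sq t).differentiableAt, ?_⟩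
  have : deriv (fun s : ℝ => max 0 s ^ 2) = fun t => 2 * max 0 t :=
    funext fun t => (hasDerivAt_max_zero_sq t).deriv
  rw [this]
  fun_prop

section Bump

variable {E : Type*} [NormedAddCommGroup E]

/-- A `C¹` bump of height `2 r / 3` supported in the closed ball of radius `r` around `c`. -/
noncomputable def parabolicBump (c : E) (r : ℝ) (z : E) : ℝ :=
  2 / 3 * r * max 0 (1 - ‖z - c‖ ^ 2 / r ^ 2) ^ 2

theorem parabolicBump_nonneg (c : E) {r : ℝ} (hr : 0 < r) (z : E) : 0 ≤ parabolicBump c r z := by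
  unfold parabolicBump
  positivity

theorem max_zero_one_sub_le_one (c z : E) (r : ℝ) : max 0 (1 - ‖z - c‖ ^ 2 / r ^ 2) ≤ 1 :=
  max_le zero_le_one (sub_le_self _ (by positivity))

theorem parabolicBump_le (c : E) {r : ℝ} (hr : 0 < r) (z : E) :
    parabolicBump c r z ≤ 2 / 3 * r :=
  mul_le_of_le_one_right (by positivity)
    (pow_le_one₀ (le_max_left _ _) (max_zero_one_sub_le_one c z r))

theorem parabolicBump_self (c : E) (r : ℝ) : parabolicBump c r c = 2 / 3 * r := by
  simp [parabolicBump]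

theorem dist_lt_of_max_ne_zero {c z : E} {r : ℝ} (hr : 0 < r)
    (h : max 0 (1 - ‖z - c‖ ^ 2 / r ^ 2) ≠ 0) : dist z c < r := by
  by_contra! hle
  refine h (max_eq_left ?_)
  rw [sub_nonpos, one_le_div (by positivity), ← dist_eq_norm]
  gcongr

theorem dist_lt_of_parabolicBump_ne_zero {c z : E} {r : ℝ} (hr : 0 < r)
    (h : parabolicBump c r z ≠ 0) : dist z c < r :=
  dist_lt_of_max_ne_zero hr fun h0 => h (by simp [parabolicBump, h0])

variable [InnerProductSpace ℝ E]

theorem contDiff_parabolicBump (c : E) (r : ℝ) : ContDiff ℝ 1 (parabolicBump c r) := by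
  have h : ContDiff ℝ 1 fun z : E => 1 - ‖z - c‖ ^ 2 / r ^ 2 :=
    contDiff_const.sub (((contDiff_id.sub contDiff_const).norm_sq ℝ).div_const _)
  exact contDiff_const.mul (contDiff_max_zero_sq.comp h)

variable [CompleteSpace E]

theorem hasGradientAt_parabolicBump (c : E) {r : ℝ} (hr : 0 < r) (z : E) :
    HasGradientAt (parabolicBump c r)
      ((-(8 / 3) / r * max 0 (1 - ‖z - c‖ ^ 2 / r ^ 2)) • (z - c)) z := by
  rw [hasGradientAt_iff_hasFDerivAt]
  have h1 : HasFDerivAt (fun z : E => 1 - ‖z - c‖ ^ 2 / r ^ 2)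
      (-((r ^ 2)⁻¹ • (2 • innerSL ℝ (z - c)))) z := by
    have := (((hasFDerivAt_id z).sub_const c).norm_sq.mul_const (r ^ 2)⁻¹).const_sub 1
    simpa [div_eq_mul_inv] using this
  have h2 := ((hasDerivAt_max_zero_sq _).comp_hasFDerivAt z h1).const_mul (2 / 3 * r)
  refine h2.congr_fderiv ?_
  ext v
  simp
  field_simp
  ring

theorem norm_gradient_parabolicBump_le (c : E) {r : ℝ} (hr : 0 < r) (z : E) :
    ‖gradient (parabolicBump c r) z‖ ≤ 3 := by
  rw [(hasGradientAt_parabolicBump c hr z).gradient, norm_smul]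
  set m := max 0 (1 - ‖z - c‖ ^ 2 / r ^ 2) with hm
  rcases eq_or_ne m 0 with h0 | h0
  · simp [h0]
  have hd : ‖z - c‖ ≤ r := by
    rw [← dist_eq_norm]
    exact (dist_lt_of_max_ne_zero hr h0).le
  have hm0 : 0 ≤ m := le_max_left _ _
  have hm1 : m ≤ 1 := max_zero_one_sub_le_one c z r
  rw [Real.norm_eq_abs, abs_mul, abs_div, abs_of_pos hr, abs_of_nonneg hm0]
  calc |(-(8 / 3) : ℝ)| / r * m * ‖z - c‖ ≤ |(-(8 / 3) : ℝ)| / r * 1 * r := by gcongr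
    _ ≤ 3 := by
      rw [mul_one, div_mul_cancel₀ _ hr.ne', abs_neg, abs_of_pos] <;> norm_num

theorem eq_center_of_gradient_parabolicBump_eq_zero {c z : E} {r : ℝ} (hr : 0 < r)
    (hz : parabolicBump c r z ≠ 0) (hg : gradient (parabolicBump c r) z = 0) : z = c := by
  rw [(hasGradientAt_parabolicBump c hr z).gradient, smul_eq_zero] at hg
  rcases hg with hg | hg
  · refine absurd ?_ hz
    have hm : max 0 (1 - ‖z - c‖ ^ 2 / r ^ 2) = 0 := by
      rcases mul_eq_zero.1 hg with h | h
      · exact absurd h (by simp [hr.ne'])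
      · exact h
    simp [parabolicBump, hm]
  · exact sub_eq_zero.1 hg

/-- The height factor `2 / 3` is chosen for this: at half radius the gradient has norm `(8 / 3) * (3
/ 4) * (1 / 2) = 1`, whatever `r` is. -/
theorem gradient_parabolicBump_sub_smul (c : E) {r : ℝ} (hr : 0 < r) {e : E} (he : ‖e‖ = 1) :
    gradient (parabolicBump c r) (c - (r / 2) • e) = e := by
  rw [(hasGradientAt_parabolicBump c hr _).gradient]
  have h1 : c - (r / 2) • e - c = (-(r / 2)) • e := by rw [neg_smul]; abel
  rw [h1, norm_smul, he, mul_one, smul_smul, Real.norm_eq_abs, sq_abs]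
  have h2 : 1 - (-(r / 2)) ^ 2 / r ^ 2 = 3 / 4 := by
    field_simp
    norm_num
  rw [h2, max_eq_right (by norm_num)]
  have h3 : -(8 / 3) / r * (3 / 4) * -(r / 2) = 1 := by
    field_simp
    norm_num
  rw [h3, one_smul]

end Bump

/-! ### Sums of disjoint bumps accumulating at a closed set -/

section BumpSum

variable {E : Type*} [NormedAddCommGroup E] {S : Set E} {c : ℕ → E}

/-- The radius of the bump centered at `c`. -/
noncomputable def bumpRadius (S : Set E) (c : E) : ℝ := Metric.infDist c S ^ 2 / 4

/-- The sum of the bumps centered at the points `c k`. -/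
noncomputable def bumpSum (S : Set E) (c : ℕ → E) (z : E) : ℝ :=
  ∑' k, parabolicBump (c k) (bumpRadius S (c k)) z

/-- The points `c k` lie off `S`, approach `S` geometrically fast, and accumulate at every point
of `S`. -/
structure IsBumpSequence (S : Set E) (c : ℕ → E) : Prop where
  infDist_pos : ∀ k, 0 < Metric.infDist (c k) S
  infDist_le_one : ∀ k, Metric.infDist (c k) S ≤ 1
  infDist_succ_le : ∀ k, Metric.infDist (c (k + 1)) S ≤ Metric.infDist (c k) S / 2
  exists_dist_lt : ∀ z ∈ S, ∀ ε > 0, ∃ k, dist (c k) z < ε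

theorem exists_isBumpSequence [TopologicalSpace.SeparableSpace S] (hS : IsClosed S)
    (hne : S.Nonempty) (hint : interior S = ∅) : ∃ c, IsBumpSequence S c := by
  have hext : ∀ s ∈ S, ∀ δ > 0, ∃ c, c ∉ S ∧ dist c s < δ := by
    intro s _ δ hδ
    have hs : s ∈ closure Sᶜ := by simp [closure_compl, hint]
    obtain ⟨c, hc, hd⟩ := Metric.mem_closure_iff.1 hs δ hδ
    exact ⟨c, hc, by rwa [dist_comm]⟩
  have : Nonempty S := hne.to_subtype
  -- Unpairing makes every term of the dense sequence recur infinitely often, as centres must come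
  -- arbitrarily close to each.
  set s : ℕ → S := fun k => TopologicalSpace.denseSeq S (Nat.unpair k).1 with hs
  have hstep : ∀ (k : ℕ) (δ : {δ : ℝ // 0 < δ}), ∃ c, c ∉ S ∧ dist c (s k) < δ :=
    fun k δ => hext _ (s k).2 _ δ.2
  choose g hgS hgd using hstep
  have hpos : ∀ x ∉ S, 0 < Metric.infDist x S := fun x hx =>
    (hS.notMem_iff_infDist_pos hne).1 hx
  -- The first bound yields accumulation at `S`, the second the geometric decay of the distances.
  let bound : ∀ _ : ℕ, {x // x ∉ S} → {δ : ℝ // 0 < δ} := fun k x =>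
    ⟨min (1 / ((k : ℝ) + 1)) (Metric.infDist x.1 S / 2),
      lt_min (by positivity) (half_pos (hpos _ x.2))⟩
  let c : ℕ → {x // x ∉ S} := Nat.rec ⟨g 0 ⟨1, one_pos⟩, hgS _ _⟩
    (fun k x => ⟨g (k + 1) (bound k x), hgS _ _⟩)
  have hc1 : ∀ k, dist (c (k + 1)).1 (s (k + 1)) < min (1 / ((k : ℝ) + 1))
      (Metric.infDist (c k).1 S / 2) := fun k => hgd (k + 1) (bound k (c k))
  have hsucc : ∀ k, Metric.infDist (c (k + 1)).1 S ≤ Metric.infDist (c k).1 S / 2 := fun k =>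
    (Metric.infDist_le_dist_of_mem (s (k + 1)).2).trans
      ((hc1 k).le.trans (min_le_right _ _))
  refine ⟨fun k => (c k).1, fun k => hpos _ (c k).2, fun k => ?_, hsucc, ?_⟩
  · induction k with
    | zero => exact (Metric.infDist_le_dist_of_mem (s 0).2).trans (hgd 0 ⟨1, one_pos⟩).le
    | succ k ih =>
      have h0 : 0 ≤ Metric.infDist (c k).1 S := Metric.infDist_nonneg
      have := hsucc k
      linarith
  · intro z hz ε hε
    obtain ⟨i, hi⟩ := (TopologicalSpace.denseRange_denseSeq S).exists_dist_lt ⟨z, hz⟩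
      (half_pos hε)
    obtain ⟨m, hm⟩ := exists_nat_one_div_lt (half_pos hε)
    -- The bound governs only centres of successor index, hence `m + 1` in place of `m`.
    obtain ⟨k, hk⟩ : ∃ k, Nat.pair i (m + 1) = k + 1 := by
      refine Nat.exists_eq_succ_of_ne_zero ?_
      have := Nat.right_le_pair i (m + 1)
      omega
    have hmk : m ≤ k := by
      have := Nat.right_le_pair i (m + 1)
      omega
    have hsk : s (k + 1) = TopologicalSpace.denseSeq S i := by
      simp only [hs, ← hk, Nat.unpair_pair]
    refine ⟨k + 1, ?_⟩
    have h1 : dist (c (k + 1)).1 (s (k + 1)) < ε / 2 := by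
      refine (hc1 k).trans_le ((min_le_left _ _).trans (le_trans ?_ hm.le))
      gcongr
    have h2 : dist ((s (k + 1) : S) : E) z < ε / 2 := by
      rw [hsk, dist_comm]
      exact hi
    linarith [dist_triangle (c (k + 1)).1 ((s (k + 1) : S) : E) z]

namespace IsBumpSequence

theorem bumpRadius_pos (hc : IsBumpSequence S c) (k : ℕ) : 0 < bumpRadius S (c k) :=
  div_pos (pow_pos (hc.infDist_pos k) 2) (by norm_num)

theorem bumpRadius_le (hc : IsBumpSequence S c) (k : ℕ) :
    bumpRadius S (c k) ≤ Metric.infDist (c k) S / 4 := by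
  have h0 := hc.infDist_pos k
  have h1 := hc.infDist_le_one k
  unfold bumpRadius
  nlinarith

theorem antitone_infDist (hc : IsBumpSequence S c) :
    Antitone fun k => Metric.infDist (c k) S :=
  antitone_nat_of_succ_le fun k => by
    linarith [hc.infDist_succ_le k, hc.infDist_pos k]

theorem infDist_le_half (hc : IsBumpSequence S c) {j k : ℕ} (h : j < k) :
    Metric.infDist (c k) S ≤ Metric.infDist (c j) S / 2 :=
  (hc.antitone_infDist h).trans (hc.infDist_succ_le j)

theorem injective (hc : IsBumpSequence S c) : Function.Injective c := by
  have hanti : StrictAnti fun k => Metric.infDist (c k) S := fun j k hjk => by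
    linarith [hc.infDist_le_half hjk, hc.infDist_pos j]
  exact fun j k h => hanti.injective (congrArg (Metric.infDist · S) h)

/-- Distances to `S` of distinct centres differ by a factor of at least `2`. This is what separates
the bumps. -/
theorem eq_of_infDist_lt (hc : IsBumpSequence S c) {j k : ℕ}
    (h1 : Metric.infDist (c j) S < 2 * Metric.infDist (c k) S)
    (h2 : Metric.infDist (c k) S < 2 * Metric.infDist (c j) S) : j = k := by
  rcases lt_trichotomy j k with h | h | h
  · linarith [hc.infDist_le_half h]
  · exact h
  · linarith [hc.infDist_le_half h]

/-- The radius is at most a quarter of the centre's distance to `S`. As `(5 / 4) / (3 / 4) < 2`, no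
point lies in two bumps. -/
theorem infDist_mem_of_dist_lt (hc : IsBumpSequence S c) {k : ℕ} {z : E}
    (h : dist z (c k) < bumpRadius S (c k)) :
    3 / 4 * Metric.infDist (c k) S < Metric.infDist z S ∧
      Metric.infDist z S < 5 / 4 * Metric.infDist (c k) S := by
  have h1 := hc.bumpRadius_le k
  have h2 : Metric.infDist z S ≤ Metric.infDist (c k) S + dist z (c k) :=
    Metric.infDist_le_infDist_add_dist
  have h3 : Metric.infDist (c k) S ≤ Metric.infDist z S + dist (c k) z :=
    Metric.infDist_le_infDist_add_dist
  rw [dist_comm] at h3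
  constructor <;> linarith

theorem bumpSum_eq_of_dist_lt (hc : IsBumpSequence S c) {k : ℕ} {z : E}
    (h : dist z (c k) < bumpRadius S (c k)) :
    bumpSum S c z = parabolicBump (c k) (bumpRadius S (c k)) z := by
  refine tsum_eq_single k fun j hjk => ?_
  by_contra hne
  have hj := hc.infDist_mem_of_dist_lt (dist_lt_of_parabolicBump_ne_zero (hc.bumpRadius_pos j) hne)
  have hk := hc.infDist_mem_of_dist_lt h
  have h1 := hc.infDist_pos j
  have h2 := hc.infDist_pos k
  exact hjk (hc.eq_of_infDist_lt (by linarith) (by linarith))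

theorem bumpSum_eventuallyEq_of_dist_lt (hc : IsBumpSequence S c) {k : ℕ} {z : E}
    (h : dist z (c k) < bumpRadius S (c k)) :
    bumpSum S c =ᶠ[𝓝 z] parabolicBump (c k) (bumpRadius S (c k)) := by
  filter_upwards [Metric.isOpen_ball.mem_nhds h] with w hw
  exact hc.bumpSum_eq_of_dist_lt hw

theorem bumpSum_eq_zero_or (hc : IsBumpSequence S c) (z : E) :
    bumpSum S c z = 0 ∨ ∃ k, dist z (c k) < bumpRadius S (c k) := by
  by_cases h : ∃ k, parabolicBump (c k) (bumpRadius S (c k)) z ≠ 0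
  · obtain ⟨k, hk⟩ := h
    exact Or.inr ⟨k, dist_lt_of_parabolicBump_ne_zero (hc.bumpRadius_pos k) hk⟩
  · push Not at h
    exact Or.inl (by simp [bumpSum, h])

/-- Off `S`, the sum has locally at most one nonzero term. -/
theorem bumpSum_eventuallyEq (hc : IsBumpSequence S c) {z : E} (hz : 0 < Metric.infDist z S) :
    bumpSum S c =ᶠ[𝓝 z] 0 ∨
      ∃ k, bumpSum S c =ᶠ[𝓝 z] parabolicBump (c k) (bumpRadius S (c k)) := by
  set ρ := Metric.infDist z S
  -- The margins leave the admissible centre distances between `19 / 25 * ρ` and `7 / 5 * ρ`, whose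
  -- ratio `35 / 19` is still below `2`.
  have hV : ∀ᶠ w in 𝓝 z, Metric.infDist w S ∈ Ioo (19 / 20 * ρ) (21 / 20 * ρ) :=
    (Metric.continuous_infDist_pt S).continuousAt.eventually
      (Ioo_mem_nhds (by linarith) (by linarith))
  have hterm : ∀ w, Metric.infDist w S ∈ Ioo (19 / 20 * ρ) (21 / 20 * ρ) → ∀ j,
      parabolicBump (c j) (bumpRadius S (c j)) w ≠ 0 →
      19 / 25 * ρ < Metric.infDist (c j) S ∧ Metric.infDist (c j) S < 7 / 5 * ρ := by
    intro w hw j hj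
    have := hc.infDist_mem_of_dist_lt (dist_lt_of_parabolicBump_ne_zero (hc.bumpRadius_pos j) hj)
    constructor <;> linarith [hw.1, hw.2]
  by_cases h : ∃ k, 19 / 25 * ρ < Metric.infDist (c k) S ∧ Metric.infDist (c k) S < 7 / 5 * ρ
  · obtain ⟨k, hk⟩ := h
    refine Or.inr ⟨k, ?_⟩
    filter_upwards [hV] with w hw
    refine tsum_eq_single k fun j hjk => ?_
    by_contra hne
    have hj := hterm w hw j hne
    exact hjk (hc.eq_of_infDist_lt (by linarith) (by linarith))
  · refine Or.inl ?_
    filter_upwards [hV] with w hw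
    have h0 : ∀ j, parabolicBump (c j) (bumpRadius S (c j)) w = 0 := fun j => by
      by_contra hne
      exact h ⟨j, hterm w hw j hne⟩
    simp [bumpSum, h0]

theorem bumpSum_nonneg (hc : IsBumpSequence S c) (z : E) : 0 ≤ bumpSum S c z :=
  tsum_nonneg fun k => parabolicBump_nonneg _ (hc.bumpRadius_pos k) z

theorem bumpSum_le_infDist_sq (hc : IsBumpSequence S c) (z : E) :
    bumpSum S c z ≤ Metric.infDist z S ^ 2 := by
  rcases hc.bumpSum_eq_zero_or z with h | ⟨k, hk⟩
  · rw [h]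
    positivity
  · rw [hc.bumpSum_eq_of_dist_lt hk]
    refine (parabolicBump_le _ (hc.bumpRadius_pos k) z).trans ?_
    have h1 := (hc.infDist_mem_of_dist_lt hk).1
    have h2 := hc.infDist_pos k
    unfold bumpRadius
    nlinarith

theorem bumpSum_eq_zero (hc : IsBumpSequence S c) {z : E} (hz : z ∈ S) : bumpSum S c z = 0 := by
  refine le_antisymm ?_ (hc.bumpSum_nonneg z)
  simpa [Metric.infDist_zero_of_mem hz] using hc.bumpSum_le_infDist_sq z

variable [InnerProductSpace ℝ E]

theorem hasFDerivAt_bumpSum (hc : IsBumpSequence S c) {z : E} (hz : z ∈ S) :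
    HasFDerivAt (bumpSum S c) (0 : E →L[ℝ] ℝ) z := by
  rw [hasFDerivAt_iff_isLittleO_nhds_zero]
  have h1 : (fun h : E => bumpSum S c (z + h)) =O[𝓝 0] fun h : E => ‖h‖ ^ 2 := by
    refine Asymptotics.IsBigO.of_bound 1 (Eventually.of_forall fun h => ?_)
    rw [Real.norm_of_nonneg (hc.bumpSum_nonneg _), norm_pow, norm_norm, one_mul]
    refine (hc.bumpSum_le_infDist_sq _).trans ?_
    gcongr
    · exact Metric.infDist_nonneg
    · simpa [dist_eq_norm] using Metric.infDist_le_dist_of_mem (x := z + h) hz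
  simpa [hc.bumpSum_eq_zero hz] using h1.trans_isLittleO
    (Asymptotics.isLittleO_norm_pow_id one_lt_two)

theorem contDiffAt_bumpSum (hc : IsBumpSequence S c) {z : E} (hz : 0 < Metric.infDist z S) :
    ContDiffAt ℝ 1 (bumpSum S c) z := by
  rcases hc.bumpSum_eventuallyEq hz with h | ⟨k, h⟩
  · exact contDiffAt_const.congr_of_eventuallyEq h
  · exact (contDiff_parabolicBump _ _).contDiffAt.congr_of_eventuallyEq h

theorem differentiable_bumpSum (hc : IsBumpSequence S c) (hS : IsClosed S) (hne : S.Nonempty) :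
    Differentiable ℝ (bumpSum S c) := by
  intro z
  by_cases hz : z ∈ S
  · exact (hc.hasFDerivAt_bumpSum hz).differentiableAt
  · exact (hc.contDiffAt_bumpSum ((hS.notMem_iff_infDist_pos hne).1 hz)).differentiableAt
      one_ne_zero

theorem contDiffOn_bumpSum (hc : IsBumpSequence S c) (hS : IsClosed S) (hne : S.Nonempty) :
    ContDiffOn ℝ 1 (bumpSum S c) Sᶜ := fun _ hz =>
  (hc.contDiffAt_bumpSum ((hS.notMem_iff_infDist_pos hne).1 hz)).contDiffWithinAt

variable [CompleteSpace E]

theorem norm_gradient_bumpSum_le (hc : IsBumpSequence S c) (hS : IsClosed S) (hne : S.Nonempty)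
    (z : E) : ‖gradient (bumpSum S c) z‖ ≤ 3 := by
  by_cases hz : z ∈ S
  · simp [gradient, (hc.hasFDerivAt_bumpSum hz).fderiv]
  · rcases hc.bumpSum_eventuallyEq ((hS.notMem_iff_infDist_pos hne).1 hz) with h | ⟨k, h⟩
    · simp [gradient, h.fderiv_eq]
    · rw [gradient, h.fderiv_eq]
      exact norm_gradient_parabolicBump_le _ (hc.bumpRadius_pos k) z

theorem locallyLipschitz_bumpSum (hc : IsBumpSequence S c) (hS : IsClosed S) (hne : S.Nonempty) :
    LocallyLipschitz (bumpSum S c) := by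
  refine (lipschitzWith_of_nnnorm_fderiv_le (𝕜 := ℝ) (C := 3)
    (hc.differentiable_bumpSum hS hne) fun z => ?_).locallyLipschitz
  have := hc.norm_gradient_bumpSum_le hS hne z
  rw [gradient, LinearIsometryEquiv.norm_map] at this
  exact_mod_cast this

/-- Inside its open ball a bump has a positive factor times `c k - z` as gradient, so its centre is
the only critical point there. -/
theorem setOf_localMax_bumpSum (hc : IsBumpSequence S c) :
    {z | 0 < bumpSum S c z ∧ IsLocalMax (bumpSum S c) z} = range c := by
  ext z
  constructor
  · rintro ⟨h0, hm⟩
    rcases hc.bumpSum_eq_zero_or z with h | ⟨k, hk⟩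
    · exact absurd h h0.ne'
    · have heq := hc.bumpSum_eventuallyEq_of_dist_lt hk
      refine ⟨k, (eq_center_of_gradient_parabolicBump_eq_zero (hc.bumpRadius_pos k) ?_ ?_).symm⟩
      · rw [← heq.eq_of_nhds]
        exact h0.ne'
      · rw [gradient, ← heq.fderiv_eq, hm.fderiv_eq_zero, map_zero]
  · rintro ⟨k, rfl⟩
    have hr := hc.bumpRadius_pos k
    have heq := hc.bumpSum_eventuallyEq_of_dist_lt (k := k) (z := c k) (by simpa using hr)
    have hval : bumpSum S c (c k) = 2 / 3 * bumpRadius S (c k) := by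
      rw [heq.eq_of_nhds, parabolicBump_self]
    refine ⟨by rw [hval]; positivity, ?_⟩
    filter_upwards [heq] with w hw
    rw [hw, hval]
    exact parabolicBump_le _ hr w

/-- Every unit vector is a limiting gradient at every point of `S`. -/
theorem mem_clarkeSubdiff_bumpSum (hc : IsBumpSequence S c) (hS : IsClosed S) (hne : S.Nonempty)
    {z e : E} (hz : z ∈ S) (he : ‖e‖ = 1) : e ∈ clarkeSubdiff (bumpSum S c) z := by
  refine subset_convexHull ℝ _ ?_
  choose k hk using fun n : ℕ =>
    hc.exists_dist_lt z hz (1 / ((n : ℝ) + 1)) Nat.one_div_pos_of_nat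
  set y : ℕ → E := fun n => c (k n) - (bumpRadius S (c (k n)) / 2) • e with hy
  have hdist : ∀ n, dist (y n) (c (k n)) = bumpRadius S (c (k n)) / 2 := fun n => by
    rw [hy, dist_eq_norm, sub_sub_cancel_left, norm_neg, norm_smul, he, mul_one,
      Real.norm_of_nonneg (half_pos (hc.bumpRadius_pos _)).le]
  refine ⟨y, fun n => hc.differentiable_bumpSum hS hne _, ?_, ?_⟩
  · rw [tendsto_iff_dist_tendsto_zero]
    have hlim : Tendsto (fun n : ℕ => 2 * (1 / ((n : ℝ) + 1))) atTop (𝓝 0) := by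
      simpa using tendsto_one_div_add_atTop_nhds_zero_nat.const_mul (2 : ℝ)
    refine squeeze_zero (fun _ => dist_nonneg) (fun n => ?_) hlim
    have h1 := dist_triangle (y n) (c (k n)) z
    have h2 := hc.bumpRadius_le (k n)
    have h3 : Metric.infDist (c (k n)) S ≤ dist (c (k n)) z := Metric.infDist_le_dist_of_mem hz
    have h4 := hc.infDist_pos (k n)
    linarith [hk n, hdist n]
  · refine tendsto_const_nhds.congr fun n => ?_
    have hr := hc.bumpRadius_pos (k n)
    rw [gradient, (hc.bumpSum_eventuallyEq_of_dist_lt (k := k n) (z := y n) ?_).fderiv_eq]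
    · exact (gradient_parabolicBump_sub_smul _ hr he).symm
    · rw [hdist]
      exact half_lt_self hr

end IsBumpSequence

end BumpSum

end AdjointFailure

namespace AdjointFailure

/-! ### Curves meeting a set with null projections -/

/-- A real function has almost everywhere a zero derivative on a set with null image. -/
theorem volume_deriv_ne_zero_eq_zero {p : ℝ → ℝ} {A : Set ℝ} (hA : volume (p '' A) = 0) :
    volume {t ∈ A | DifferentiableAt ℝ p t ∧ deriv p t ≠ 0} = 0 := by
  -- On each piece `p` expands distances up to a constant: the rational `q` localizes it to diameter
  -- below `1 / (n + 1)`, the scale at which the estimate holds.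
  set B : ℕ → ℚ → Set ℝ := fun n q => {t ∈ A | |t - q| < 1 / ((n : ℝ) + 1) / 2 ∧
    ∀ s, |s - t| < 1 / ((n : ℝ) + 1) → |s - t| ≤ (n + 1) * |p s - p t|} with hB
  have hBnull : ∀ n q, volume (B n q) = 0 := by
    intro n q
    have hexp : ∀ s ∈ B n q, ∀ t ∈ B n q, |s - t| ≤ (n + 1) * |p s - p t| := by
      intro s hs t ht
      refine ht.2.2 s ?_
      have h1 := hs.2.1
      have h2 := ht.2.1
      rw [abs_sub_comm] at h2
      linarith [abs_sub_le s q t]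
    have hinj : InjOn p (B n q) := by
      intro s hs t ht hst
      have := hexp s hs t ht
      rw [hst, sub_self, abs_zero, mul_zero] at this
      exact sub_eq_zero.1 (abs_nonpos_iff.1 this)
    have hlip : LipschitzOnWith (n + 1) (Function.invFunOn p (B n q)) (p '' B n q) := by
      refine LipschitzOnWith.of_dist_le_mul ?_
      rintro _ ⟨s, hs, rfl⟩ _ ⟨t, ht, rfl⟩
      rw [hinj.leftInvOn_invFunOn hs, hinj.leftInvOn_invFunOn ht, Real.dist_eq, Real.dist_eq]
      exact_mod_cast hexp s hs t ht
    have himg : Function.invFunOn p (B n q) '' (p '' B n q) = B n q :=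
      hinj.invFunOn_image Subset.rfl
    -- The Lipschitz inverse carries the null image back onto `B n q`; in dimension one, Hausdorff
    -- measure is Lebesgue measure.
    have hle := hlip.hausdorffMeasure_image_le zero_le_one
    rw [himg, hausdorffMeasure_real,
      measure_mono_null (image_mono fun t ht => ht.1) hA, mul_zero] at hle
    exact nonpos_iff_eq_zero.1 hle
  refine measure_mono_null ?_ (measure_iUnion_null fun n => measure_iUnion_null (hBnull n))
  rintro t ⟨htA, hd, hne⟩
  have ho := hd.hasDerivAt.isLittleO.def (half_pos (abs_pos.2 hne))
  obtain ⟨δ, hδ, hball⟩ := Metric.eventually_nhds_iff.1 ho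
  obtain ⟨n, hn⟩ := exists_nat_one_div_lt (lt_min hδ (half_pos (abs_pos.2 hne)))
  have hn0 : (0 : ℝ) < n + 1 := by positivity
  obtain ⟨q, hq1, hq2⟩ := exists_rat_btwn (show t < t + 1 / ((n : ℝ) + 1) / 2 by
    have : (0 : ℝ) < 1 / (n + 1) / 2 := by positivity
    linarith)
  refine mem_iUnion.2 ⟨n, mem_iUnion.2 ⟨q, htA, ?_, fun s hs => ?_⟩⟩
  · rw [abs_lt]
    constructor <;> linarith
  · have h1 := hball (show dist s t < δ from hs.trans (hn.trans_le (min_le_left _ _)))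
    rw [Real.norm_eq_abs, Real.norm_eq_abs, smul_eq_mul] at h1
    have h2 : |(s - t) * deriv p t| ≤ |p s - p t| + |p s - p t - (s - t) * deriv p t| := by
      have := abs_sub (p s - p t) (p s - p t - (s - t) * deriv p t)
      rwa [sub_sub_cancel] at this
    rw [abs_mul] at h2
    have h3 : 1 / ((n : ℝ) + 1) * |s - t| ≤ |deriv p t| / 2 * |s - t| :=
      mul_le_mul_of_nonneg_right (hn.le.trans (min_le_right _ _)) (abs_nonneg _)
    have h4 : 1 / ((n : ℝ) + 1) * |s - t| ≤ |p s - p t| := by linarith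
    rw [one_div, inv_mul_le_iff₀ hn0] at h4
    exact h4

/-- A curve in the plane has almost everywhere a zero velocity on a set whose projections on the
axes of an orthonormal frame are null. -/
theorem volume_deriv_ne_zero_of_null_projections {S : Set Plane} {α : ℝ}
    (h1 : volume ((fun z : Plane => Real.cos α * z 0 + Real.sin α * z 1) '' S) = 0)
    (h2 : volume ((fun z : Plane => -Real.sin α * z 0 + Real.cos α * z 1) '' S) = 0)
    (u : ℝ → Plane) :
    volume {t | u t ∈ S ∧ DifferentiableAt ℝ u t ∧ deriv u t ≠ 0} = 0 := by
  have key : ∀ a b : ℝ, volume ((fun z : Plane => a * z 0 + b * z 1) '' S) = 0 →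
      volume {t ∈ u ⁻¹' S | DifferentiableAt ℝ (fun s => a * u s 0 + b * u s 1) t ∧
        deriv (fun s => a * u s 0 + b * u s 1) t ≠ 0} = 0 := by
    intro a b h
    refine volume_deriv_ne_zero_eq_zero (measure_mono_null ?_ h)
    rintro _ ⟨t, ht, rfl⟩
    exact ⟨u t, ht, rfl⟩
  refine measure_mono_null ?_ (measure_union_null (key _ _ h1) (key _ _ h2))
  rintro t ⟨htS, hd, hne⟩
  have hcoord : ∀ i, HasDerivAt (fun s => u s i) (deriv u t i) t := fun i =>
    (EuclideanSpace.proj (𝕜 := ℝ) i : Plane →L[ℝ] ℝ).hasFDerivAt.comp_hasDerivAt t hd.hasDerivAt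
  have hlin : ∀ a b : ℝ, HasDerivAt (fun s => a * u s 0 + b * u s 1)
      (a * deriv u t 0 + b * deriv u t 1) t := fun a b =>
    ((hcoord 0).const_mul a).add ((hcoord 1).const_mul b)
  by_contra hnot
  simp only [mem_union, not_or, mem_ofPred_eq, not_and, not_not] at hnot
  have e1 := hnot.1 htS (hlin _ _).differentiableAt
  have e2 := hnot.2 htS (hlin _ _).differentiableAt
  rw [(hlin _ _).deriv] at e1 e2
  have hsc := Real.sin_sq_add_cos_sq α
  refine hne ?_
  ext i
  fin_cases i
  · simp only [Fin.zero_eta, Fin.isValue, PiLp.zero_apply]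
    linear_combination Real.cos α * e1 - Real.sin α * e2 - deriv u t 0 * hsc
  · simp only [Fin.mk_one, Fin.isValue, PiLp.zero_apply]
    linear_combination Real.sin α * e1 + Real.cos α * e2 - deriv u t 1 * hsc

/-- A ball in `S` would contain a segment parallel to the axis, which projects onto it
isometrically. -/
theorem interior_eq_empty_of_null_projection {S : Set Plane} {α : ℝ}
    (h : volume ((fun z : Plane => Real.cos α * z 0 + Real.sin α * z 1) '' S) = 0) :
    interior S = ∅ := by
  by_contra hne
  obtain ⟨z, hz⟩ := nonempty_iff_ne_empty.2 hne
  set e : Plane := !₂[Real.cos α, Real.sin α] with he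
  have hcont : Continuous fun t : ℝ => z + t • e := by fun_prop
  have hopen : IsOpen ((fun t : ℝ => z + t • e) ⁻¹' interior S) :=
    isOpen_interior.preimage hcont
  have hpos : 0 < volume ((fun t : ℝ => z + t • e) ⁻¹' interior S) :=
    hopen.measure_pos volume ⟨0, by simpa using hz⟩
  refine hpos.ne' ?_
  -- After this shift the parameter equals the value of the functional at the corresponding point of
  -- the line.
  rw [← measure_preimage_add volume (-(Real.cos α * z 0 + Real.sin α * z 1))]
  refine measure_mono_null ?_ h
  intro s hs
  refine ⟨_, interior_subset hs, ?_⟩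
  have hsc := Real.sin_sq_add_cos_sq α
  simp [he]
  linear_combination (s - (Real.cos α * z 0 + Real.sin α * z 1)) * hsc

/-- A differentiable function with bounded gradient, which is `C¹` off a closed set on which
curves have almost everywhere a zero velocity, is path differentiable. -/
theorem pathDifferentiable_of_contDiffOn_compl {E : Type*} [NormedAddCommGroup E]
    [InnerProductSpace ℝ E] [CompleteSpace E] {φ : E → ℝ} {S : Set E} {r : ℝ} (hS : IsClosed S)
    (hlip : LocallyLipschitz φ) (hd : Differentiable ℝ φ) (hC : ContDiffOn ℝ 1 φ Sᶜ)
    (hr : ∀ z, ‖gradient φ z‖ ≤ r)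
    (hnull : ∀ u : ℝ → E, volume {t | u t ∈ S ∧ DifferentiableAt ℝ u t ∧ deriv u t ≠ 0} = 0) :
    PathDifferentiable φ := by
  have hgc : ContinuousOn (gradient φ) Sᶜ :=
    (InnerProductSpace.toDual ℝ E).symm.continuous.comp_continuousOn
      (hC.continuousOn_fderiv_of_isOpen hS.isOpen_compl le_rfl)
  -- The field is the closed ball of radius `r` on `S` and the gradient alone off `S`; the full ball
  -- on `S` is what closes the graph.
  refine ⟨fun z => {v | ‖v‖ ≤ r ∧ (z ∈ S ∨ v = gradient φ z)}, hlip,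
    fun z => ⟨_, hr z, Or.inr rfl⟩, fun z => ⟨univ, univ_mem, |r| + 1, by positivity, ?_⟩,
    ?_, fun u hu => ?_⟩
  · refine iUnion₂_subset fun w _ v hv => ?_
    rw [mem_closedBall_zero_iff]
    linarith [hv.1, le_abs_self r]
  · refine (isClosed_le (f := fun p : E × E => ‖p.2‖) (by fun_prop) continuous_const).inter
      (show IsClosed {p : E × E | p.1 ∈ S ∨ p.2 = gradient φ p.1} from
        isOpen_compl_iff.1 ?_)
    rw [isOpen_iff_mem_nhds]
    rintro ⟨z, v⟩ hzv
    simp only [mem_compl_iff, mem_ofPred_eq, not_or] at hzv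
    have hz : ∀ᶠ p : E × E in 𝓝 (z, v), p.1 ∈ Sᶜ :=
      continuousAt_fst.eventually (hS.isOpen_compl.mem_nhds hzv.1)
    have hg : ContinuousAt (fun p : E × E => gradient φ p.1) (z, v) :=
      ContinuousAt.comp (f := Prod.fst) (g := gradient φ)
        (hgc.continuousAt (hS.isOpen_compl.mem_nhds hzv.1)) continuousAt_fst
    filter_upwards [hz, (continuousAt_snd.prodMk hg).eventually
      ((isOpen_ne_fun continuous_fst continuous_snd).mem_nhds hzv.2)] with p hp1 hp2
    exact not_or.2 ⟨hp1, hp2⟩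
  · have hae : ∀ᵐ t ∂(volume.restrict (Icc (0 : ℝ) 1)),
        ¬ (u t ∈ S ∧ DifferentiableAt ℝ u t ∧ deriv u t ≠ 0) :=
      ae_restrict_of_ae (measure_eq_zero_iff_ae_notMem.1 (hnull u))
    filter_upwards [hu.ae_differentiable, hae] with t ht hnot v hv
    have hchain : HasDerivAt (fun s => φ (u s)) (fderiv ℝ φ (u t) (deriv u t)) t :=
      (hd (u t)).hasFDerivAt.comp_hasDerivAt t ht.hasDerivAt
    rcases hv.2 with hv' | hv'
    · have h0 : deriv u t = 0 := by
        by_contra hne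
        exact hnot ⟨hv', ht, hne⟩
      simpa [h0] using hchain
    · rw [hv', real_inner_comm, gradient, InnerProductSpace.toDual_symm_apply]
      exact hchain

/-! ### The parametric problem -/

theorem feasible_constraintG (θ : ℝ) : feasible constraintG θ = Icc (-2) 2 := by
  ext x
  simp only [feasible, constraintG, mem_ofPred_eq, mem_Icc]
  change x ^ 2 - 4 ≤ 0 ↔ _
  rw [sub_nonpos, show (4 : ℝ) = 2 ^ 2 by norm_num,
    sq_le_sq, abs_two, abs_le]

theorem gradX_constraintG (x θ : ℝ) : gradX constraintG x θ = 2 * x := by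
  have h : (fun s : ℝ => constraintG !₂[s, θ]) = fun s => s ^ 2 - 4 := rfl
  rw [gradX, h]
  simp

theorem rcq_constraintG (x θ : ℝ) : RCQ constraintG x θ := by
  intro l h1 _ h3
  rw [gradX_constraintG] at h1
  change l * (x ^ 2 - 4) = 0 at h3
  -- This rests on `x * x / 4 - (x ^ 2 - 4) / 4 = 1`: the constraint and its derivative have no
  -- common zero.
  linear_combination (x / 8) * h1 - h3 / 4

theorem solP_constraintG_subset (F : Plane → ℝ) (θ : ℝ) : solP F constraintG θ ⊆ Icc (-2) 2 :=
  fun _ hx => feasible_constraintG θ ▸ hx.1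

theorem nonempty_solP_constraintG {F : Plane → ℝ} (hF : Continuous F) (θ : ℝ) :
    (solP F constraintG θ).Nonempty := by
  have hc : Continuous fun x : ℝ => F !₂[x, θ] := by
    refine hF.comp ((PiLp.continuous_toLp 2 _).comp (continuous_pi fun i => ?_))
    fin_cases i <;> simp <;> fun_prop
  obtain ⟨x, hx, hmin⟩ := (isCompact_Icc (a := (-2 : ℝ)) (b := 2)).exists_isMinOn
    ⟨0, by norm_num⟩ hc.continuousOn
  rw [← feasible_constraintG θ] at hx hmin
  exact ⟨x, hx, fun y hy => hmin hy⟩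

theorem isLocallyBounded_solP_constraintG (F : Plane → ℝ) :
    IsLocallyBounded (solP F constraintG) := by
  refine fun θ => ⟨univ, univ_mem, 2, two_pos, iUnion₂_subset fun θ' _ x hx => ?_⟩
  rw [mem_closedBall_zero_iff, Real.norm_eq_abs, abs_le]
  exact solP_constraintG_subset F θ' hx

theorem valueFunction_eq_zero {F G : Plane → ℝ} (hF : ∀ z, 0 ≤ F z) {x θ : ℝ}
    (hx : x ∈ feasible G θ) (h0 : F !₂[x, θ] = 0) : valueFunction F G θ = 0 := by
  refine IsLeast.csInf_eq ⟨⟨x, hx, h0⟩, ?_⟩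
  rintro _ ⟨y, _, rfl⟩
  exact hF _

theorem Icc_subset_adjointMap {F G : Plane → ℝ} (hF : ∀ z, 0 ≤ F z) {x θ : ℝ}
    (hx : x ∈ feasible G θ) (h0 : F !₂[x, θ] = 0)
    (hpos : !₂[0, 1] ∈ clarkeSubdiff F !₂[x, θ]) (hneg : !₂[0, -1] ∈ clarkeSubdiff F !₂[x, θ]) :
    Icc (-1 : ℝ) 1 ⊆ adjointMap F G θ := by
  intro u hu
  refine ⟨(x, 0), ⟨⟨hx, fun y _ => h0.trans_le (hF _)⟩, ?_, le_rfl, zero_mul _⟩, !₂[0, u], ?_, ?_⟩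
  · exact ⟨0, subset_convexHull ℝ _ ⟨_, hpos, rfl⟩, by simp⟩
  · have hconv : Convex ℝ (clarkeSubdiff F !₂[x, θ]) := convex_convexHull ℝ _
    have := hconv hneg hpos (a := (1 - u) / 2) (b := (1 + u) / 2) (by linarith [hu.2])
      (by linarith [hu.1]) (by ring)
    convert this using 1
    ext i
    fin_cases i
    · simp
    · simp
      ring
  · ext i
    fin_cases i <;> simp

theorem not_isConservativeField_of_Icc_subset {f : ℝ → ℝ} {D : ℝ → Set ℝ}
    (hf : ∀ θ ∈ Icc (0 : ℝ) 1, f θ = 0) (hD : ∀ θ ∈ Icc (0 : ℝ) 1, Icc (-1 : ℝ) 1 ⊆ D θ) :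
    ¬ IsConservativeField f D := by
  intro h
  have hu : IsAbsContCurve (fun t : ℝ => t) := by
    refine ⟨Eventually.of_forall fun t => differentiableAt_id, ?_, fun a _ b _ => ?_⟩
    · simp
    · simp
  have hae := h.chainRule _ hu
  -- The endpoints are discarded so that `f` vanishes on a neighbourhood of `t`.
  have hev : ∀ᵐ t ∂(volume.restrict (Icc (0 : ℝ) 1)), t ∈ Ioo (0 : ℝ) 1 := by
    rw [Measure.restrict_congr_set Ioo_ae_eq_Icc.symm]
    exact ae_restrict_mem measurableSet_Ioo
  have hne : (ae (volume.restrict (Icc (0 : ℝ) 1))).NeBot := by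
    rw [ae_neBot]
    intro h0
    have := congrArg (fun μ : Measure ℝ => μ univ) h0
    simp at this
  obtain ⟨t, ht, htI⟩ := (hae.and hev).exists
  have h1 := ht 1 (hD t (Ioo_subset_Icc_self htI) (by norm_num))
  have h2 : HasDerivAt f 0 t := by
    refine (hasDerivAt_const t (0 : ℝ)).congr_of_eventuallyEq ?_
    filter_upwards [Ioo_mem_nhds htI.1 htI.2] with s hs
    exact hf s (Ioo_subset_Icc_self hs)
  have := h1.unique h2
  simp at this

end AdjointFailure

open AdjointFailure
theorem claim5p1 :
    (∃ P : Finset (Fin 4 × Fin 4), IsAdmissible P) ∧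
    ∀ P : Finset (Fin 4 × Fin 4), IsAdmissible P →
      ∃ F : Plane → ℝ,
        LocallyLipschitz F ∧
        (∀ O : OMinimalStructure, ¬ IsDefinable O F) ∧
        Differentiable ℝ F ∧ PathDifferentiable F ∧ ContDiffOn ℝ 1 F (fractal P)ᶜ ∧
        (∀ θ : ℝ, ∀ x ∈ feasible constraintG θ, RCQ constraintG x θ) ∧
        (∀ θ : ℝ, (solP F constraintG θ).Nonempty) ∧
        IsLocallyBounded (solP F constraintG) ∧
        (∀ θ ∈ Set.Icc (0 : ℝ) 1, valueFunction F constraintG θ = 0 ∧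
          Set.Icc (-1 : ℝ) 1 ⊆ adjointMap F constraintG θ) ∧
        ¬ IsConservativeField (valueFunction F constraintG) (adjointMap F constraintG) := by
  refine ⟨exists_isAdmissible, fun P hP => ?_⟩
  obtain ⟨α, h1, h2⟩ := hP.proj_rotated
  have hS : IsClosed (fractal P) := isClosed_fractal P
  have hne : (fractal P).Nonempty := by
    have : ((fun z : Plane => z 0) '' fractal P).Nonempty := by
      rw [hP.proj_fst]
      exact nonempty_Icc.2 zero_le_one
    exact this.of_image
  obtain ⟨c, hc⟩ := exists_isBumpSequence hS hne (interior_eq_empty_of_null_projection h1)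
  have hlip := hc.locallyLipschitz_bumpSum hS hne
  have hdiff := hc.differentiable_bumpSum hS hne
  have hval : ∀ θ ∈ Icc (0 : ℝ) 1, valueFunction (bumpSum (fractal P) c) constraintG θ = 0 ∧
      Icc (-1 : ℝ) 1 ⊆ adjointMap (bumpSum (fractal P) c) constraintG θ := by
    intro θ hθ
    -- Fullness of the second projection provides a point of the fractal above every parameter.
    rw [← hP.proj_snd] at hθ
    obtain ⟨z, hz, rfl⟩ := hθ
    have hη : (!₂[z 0, z 1] : Plane) = z := by
      ext i
      fin_cases i <;> rfl
    have hfeas : z 0 ∈ feasible constraintG (z 1) := by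
      rw [feasible_constraintG]
      obtain ⟨h0, h1⟩ := (fractal_subset_unitSquare hz).1
      exact ⟨by linarith, by linarith⟩
    have h0 : bumpSum (fractal P) c !₂[z 0, z 1] = 0 := by
      rw [hη]
      exact hc.bumpSum_eq_zero hz
    refine ⟨valueFunction_eq_zero hc.bumpSum_nonneg hfeas h0,
      Icc_subset_adjointMap hc.bumpSum_nonneg hfeas h0 ?_ ?_⟩
    · rw [hη]
      exact hc.mem_clarkeSubdiff_bumpSum hS hne hz (by simp [EuclideanSpace.norm_eq])
    · rw [hη]
      exact hc.mem_clarkeSubdiff_bumpSum hS hne hz (by simp [EuclideanSpace.norm_eq])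
  refine ⟨bumpSum (fractal P) c, hlip, ?_, hdiff, ?_, hc.contDiffOn_bumpSum hS hne,
    fun θ x _ => rcq_constraintG x θ, nonempty_solP_constraintG hdiff.continuous,
    isLocallyBounded_solP_constraintG _, hval, ?_⟩
  · refine not_isDefinable_of_countable_localMax ?_ ?_
    · rw [hc.setOf_localMax_bumpSum]
      exact countable_range c
    · rw [hc.setOf_localMax_bumpSum]
      exact infinite_range_of_injective hc.injective
  · exact pathDifferentiable_of_contDiffOn_compl hS hlip hdiff (hc.contDiffOn_bumpSum hS hne)
      (hc.norm_gradient_bumpSum_le hS hne) (volume_deriv_ne_zero_of_null_projections h1 h2)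
  · exact not_isConservativeField_of_Icc_subset (fun θ hθ => (hval θ hθ).1)
      fun θ hθ => (hval θ hθ).2
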